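/- Throughout, $\log x$ is the base-$2$ logarithm with the convention $\log x=0$ for $x\le 1$, and $\log_b$ is the base-$b$ logarithm. For integers $n,t\ge0$ and $u_0,\dots,u_{t-1}\in\mathbb N_{>0}$, consider the following game between Challenger and Powerator: in each round $i=t,\dots,t+n-1$, Challenger picks $x_i\in\mathbb N_{>0}$ and Powerator responds with $u_i\in\mathbb N_{>0}$ such that $u_i\le x_i<2u_i$. Challenger wins if $u_iu_j<u_h<2u_iu_j$ for some (not necessarily distinct) $h,i,j<t+n$; otherwise Powerator wins. The $\mathrm{PowG}$-complexity $c(u_0,\dots,u_{t-1})\in\mathbb N\cup\{\infty\}$ is the least $n$ for which Challenger has a winning strategy in this game, and $\infty$ if there is no such $n$. **Theorem.** Let $u=2^lv^r$, where $l,v,r\in\mathbb N$, $v>1$, $r>0$, and $l/\log v\ge10^8$. Then $$c(u)\ge\min\Bigl(\bigl\{\lfloor\log\lceil\log_3d\rceil\rfloor+1: d\in\mathbb N_{>0},\ d\nmid r\bigr\}\cup\bigl\{\lfloor\log\log_3\log_4(l/\log v)\rfloor+3\bigr\}\Bigr).$$ The same bound holds with $\lceil\log\log_3d\rceil$ in place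 of $\lfloor\log\lceil\log_3d\rceil\rfloor+1$, and also with $\lfloor\log\lceil\log d\rceil\rfloor$ in place of it. -/

import Mathlib

namespace PowG

/-- The logarithm to base `2`, with the convention `log x = 0` for `x ≤ 1`. -/
noncomputable def log (x : ℝ) : ℝ := if x ≤ 1 then 0 else Real.logb 2 x

/-- `u` is a legal response of Powerator to Challenger's move `x`:
`u` is a positive integer with `u ≤ x < 2u`. -/
def LegalResponse (x u : ℕ) : Prop := 0 < u ∧ u ≤ x ∧ x < 2 * u

/-- A final position, given as the list of all responses of Powerator, is won by Challenger if
`u_i u_j < u_h < 2 u_i u_j` for some (not necessarily distinct) `h, i, j`. -/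
def ChallengerWins (us : List ℕ) : Prop :=
  ∃ h i j : Fin us.length,
    us.get i * us.get j < us.get h ∧ us.get h < 2 * (us.get i * us.get j)

/-- A strategy for Challenger: a positive integer to be played at each position, a position being
the list of the responses of Powerator so far (the initial fixed ones included). -/
structure Strategy where
  move : List ℕ → ℕ
  move_pos : ∀ p, 0 < move p

/-- `ws` is the list of Powerator's responses in a play that starts from the position `us` and in
which Challenger follows the strategy `σ` and every response of Powerator is legal. -/
def Strategy.IsPlay (σ : Strategy) (us ws : List ℕ) : Prop :=
  ∀ i : Fin ws.length, LegalResponse (σ.move (us ++ ws.take i)) (ws.get i)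

/-- Challenger has a winning strategy in the power-of-2 game on the positive integers with
`us.length + n` rounds in which the first `us.length` responses of Powerator are fixed as `us`. -/
def HasWinningStrategy (us : List ℕ) (n : ℕ) : Prop :=
  ∃ σ : Strategy, ∀ ws : List ℕ, ws.length = n → σ.IsPlay us ws → ChallengerWins (us ++ ws)

/-- The `PowG`-complexity `c(us)`: the least `n` such that Challenger has a winning strategy
with `n` further rounds, and `⊤` (infinity) if there is no such `n`. -/
noncomputable def complexity (us : List ℕ) : ℕ∞ :=
  sInf {m : ℕ∞ | ∃ n : ℕ, m = n ∧ HasWinningStrategy us n}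

end PowG

/-!
Powerator only ever answers with numbers `2 ^ a * v ^ b`, identified with points `(a, b)` of height
`lam (a, b) = a + b * log v`. Challenger can only exploit the combination `p_h - p_i - p_j` of three
points if its height lies in `(0, 1)`. If its second coordinate is `0`, then its height is an
integer, which is harmless; if its two coordinates have the same sign, then its height has absolute
value at least `log v ≥ 1`, which is harmless too. So Powerator has to keep the combinations
*separated* (`Sep`): the second coordinate is `0`, or both coordinates have the same sign, the first
one with a margin `F` to spare.

With `k` rounds to go, this is required of all integer combinations of weight at most `3 ^ 2 ^ k`
(`Comb`). When Challenger asks for height `X`, put `K = 3 ^ 2 ^ k` for the number `k` of rounds that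
remain afterwards, and consider the candidates `P / m`, where `0 < m < K` and `P` is a combination
of weight at most `K - m`. A combination of weight at most `K` that involves the new point `p` is
essentially `± (m p - P)`, so `p` must be separated from all candidates. The differences of
candidates are, up to a factor less than `K ^ 2`, combinations of weight at most
`K ^ 2 = 3 ^ 2 ^ (k + 1)`, hence separated, so the candidates are ordered consistently by height and
by both coordinates, and only the nearest candidates below and above `X` matter. The point `p` is
placed between these two, with `b` a multiple of a fixed modulus and `a = ⌊X - b * log v⌋`; sharing
`b` with a candidate is allowed. This is `exists_extension`.

The requirements on the start are that the modulus, a product of numbers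
`lcm (1, …, 3 ^ 2 ^ k - 1)`, divides `r`, which holds if all `d ≤ 3 ^ (2 ^ n - 1)` divide `r`
(`modulus_dvd_lcmUpto`), and that the margin is at most `l`. The margin grows essentially like the
modulus, and the bound `4 ^ 3 ^ 2 ^ (n - 2)` for it (`marginCoeff_add_four_le`) needs
`lcm (1, …, N) < c ^ N` for some `c < 4`. Such a bound, with `c = √12` for multiples of `6`, follows
in the manner of Chebyshev from the integrality of
`lcm (1, …, M) * (6M)! / ((3M)! (2M)! M! lcm (1, …, 6M))`.
-/

namespace PowG

open Nat (lcmUpto)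
open scoped Nat

/-! ### Points and their integer combinations -/

/-- The base-`2` logarithm of `2 ^ a * v ^ b`, where `q = (a, b)` and `β = log v`. -/
noncomputable def lam (β : ℝ) (q : ℤ × ℤ) : ℝ := q.1 + q.2 * β

lemma lam_add (β : ℝ) (p q : ℤ × ℤ) : lam β (p + q) = lam β p + lam β q := by
  simp only [lam, Prod.fst_add, Prod.snd_add]; push_cast; ring

lemma lam_neg (β : ℝ) (p : ℤ × ℤ) : lam β (-p) = -lam β p := by
  simp only [lam, Prod.fst_neg, Prod.snd_neg]; push_cast; ring

lemma lam_sub (β : ℝ) (p q : ℤ × ℤ) : lam β (p - q) = lam β p - lam β q := by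
  rw [sub_eq_add_neg, lam_add, lam_neg, ← sub_eq_add_neg]

lemma lam_zsmul (β : ℝ) (m : ℤ) (p : ℤ × ℤ) : lam β (m • p) = m * lam β p := by
  simp only [lam, Prod.smul_fst, Prod.smul_snd, smul_eq_mul]; push_cast; ring

/-- `Comb S k q` says that `q` is an integer combination of elements of `S` whose coefficients
have absolute values adding up to at most `k`. -/
inductive Comb (S : Set (ℤ × ℤ)) : ℕ → ℤ × ℤ → Prop
  | zero (k : ℕ) : Comb S k 0
  | add {k : ℕ} {q p : ℤ × ℤ} : Comb S k q → p ∈ S → Comb S (k + 1) (q + p)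
  | sub {k : ℕ} {q p : ℤ × ℤ} : Comb S k q → p ∈ S → Comb S (k + 1) (q - p)

namespace Comb

variable {S : Set (ℤ × ℤ)} {j k : ℕ} {p q : ℤ × ℤ}

lemma mono (h : Comb S j q) (hjk : j ≤ k) : Comb S k q := by
  induction h generalizing k with
  | zero => exact .zero _
  | add _ hp ih =>
    obtain ⟨k, rfl⟩ := Nat.exists_eq_succ_of_ne_zero (by omega : k ≠ 0)
    exact .add (ih (by omega)) hp
  | sub _ hp ih =>
    obtain ⟨k, rfl⟩ := Nat.exists_eq_succ_of_ne_zero (by omega : k ≠ 0)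
    exact .sub (ih (by omega)) hp

lemma of_mem (h : p ∈ S) : Comb S 1 p := by simpa using (Comb.zero (S := S) 0).add h

lemma neg (h : Comb S k q) : Comb S k (-q) := by
  induction h with
  | zero => simpa using Comb.zero _
  | add _ hp ih => rw [neg_add]; exact ih.sub hp
  | sub _ hp ih => rw [neg_sub', sub_neg_eq_add]; exact ih.add hp

lemma add_comb (h : Comb S j p) (h' : Comb S k q) : Comb S (j + k) (p + q) := by
  induction h' with
  | zero => simpa using h.mono (Nat.le_add_right _ _)
  | add _ hp ih => rw [← add_assoc p]; exact ih.add hp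
  | sub _ hp ih => rw [← add_sub_assoc]; exact ih.sub hp

lemma sub_comb (h : Comb S j p) (h' : Comb S k q) : Comb S (j + k) (p - q) := by
  rw [sub_eq_add_neg]; exact h.add_comb h'.neg

lemma smul (h : Comb S k q) (m : ℕ) : Comb S (m * k) ((m : ℤ) • q) := by
  induction m with
  | zero => simpa using Comb.zero _
  | succ m ih =>
    have := ih.add_comb h
    rw [Nat.succ_mul, Nat.cast_succ, add_smul, one_smul]
    exact this

lemma eq_zero (h : Comb S 0 q) : q = 0 := by
  cases h; rfl

lemma dvd_snd {D : ℤ} (hS : ∀ p ∈ S, D ∣ p.2) (h : Comb S k q) : D ∣ q.2 := by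
  induction h with
  | zero => simp
  | add _ hp ih => exact dvd_add ih (hS _ hp)
  | sub _ hp ih => exact dvd_sub ih (hS _ hp)

lemma finite (hS : S.Finite) (k : ℕ) : {q | Comb S k q}.Finite := by
  induction k with
  | zero => exact (Set.finite_singleton 0).subset fun q hq => eq_zero hq
  | succ k ih =>
    refine ((Set.finite_singleton (0 : ℤ × ℤ)).union
      ((ih.image2 (· + ·) hS).union (ih.image2 (· - ·) hS))).subset ?_
    intro q hq
    cases hq with
    | zero => exact Or.inl rfl
    | add h hp => exact Or.inr (Or.inl ⟨_, h, _, hp, rfl⟩)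
    | sub h hp => exact Or.inr (Or.inr ⟨_, h, _, hp, rfl⟩)

/-- A combination over `insert p S` splits into a multiple of `p` and a combination over `S`. -/
lemma of_insert (h : Comb (insert p S) k q) :
    ∃ (m : ℤ) (j : ℕ) (P : ℤ × ℤ), Comb S j P ∧ m.natAbs + j ≤ k ∧ q = m • p + P := by
  induction h with
  | zero => exact ⟨0, 0, 0, .zero _, by simp, by simp⟩
  | add _ hp ih =>
    obtain ⟨m, j, P, hP, hmj, rfl⟩ := ih
    rcases hp with rfl | hp
    · exact ⟨m + 1, j, P, hP, by omega, by rw [add_smul, one_smul]; abel⟩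
    · exact ⟨m, j + 1, _, hP.add hp, by omega, by abel⟩
  | sub _ hp ih =>
    obtain ⟨m, j, P, hP, hmj, rfl⟩ := ih
    rcases hp with rfl | hp
    · exact ⟨m - 1, j, P, hP, by omega, by rw [sub_smul, one_smul]; abel⟩
    · exact ⟨m, j + 1, _, hP.sub hp, by omega, by abel⟩

end Comb

/-! ### Separation -/

/-- `q = (a, b)` is separated with margin `F`: either `2 ^ a * v ^ b` is a power of `2`, or the two
exponents have the same sign and `|a| ≥ F`. -/
def Sep (F : ℝ) (q : ℤ × ℤ) : Prop :=
  q.2 = 0 ∨ (F ≤ q.1 ∧ 0 < q.2) ∨ ((q.1 : ℝ) ≤ -F ∧ q.2 < 0)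

lemma Sep.neg {F : ℝ} {q : ℤ × ℤ} (h : Sep F q) : Sep F (-q) := by
  rcases h with h | ⟨h, h'⟩ | ⟨h, h'⟩
  · left; simp [h]
  · right; right; exact ⟨by simpa using h, by simpa using h'⟩
  · right; left; exact ⟨by simpa using (le_neg.1 h), by simpa using h'⟩

lemma Sep.mono {F F' : ℝ} {q : ℤ × ℤ} (h : Sep F q) (hF : F' ≤ F) : Sep F' q := by
  rcases h with h | ⟨h, h'⟩ | ⟨h, h'⟩
  · exact Or.inl h
  · exact Or.inr (Or.inl ⟨hF.trans h, h'⟩)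
  · exact Or.inr (Or.inr ⟨by linarith, h'⟩)

lemma Sep.of_lam_nonneg {β F : ℝ} {q : ℤ × ℤ} (hβ : 0 < β) (hF : 0 ≤ F) (h : Sep F q)
    (hq : 0 ≤ lam β q) : (q.2 = 0 ∧ 0 ≤ q.1) ∨ (0 < q.2 ∧ F ≤ q.1) := by
  rcases h with h | ⟨h, h'⟩ | ⟨h, h'⟩
  · left; refine ⟨h, ?_⟩
    rw [lam, h] at hq
    exact_mod_cast (by simpa using hq : (0 : ℝ) ≤ q.1)
  · exact Or.inr ⟨h', h⟩
  · exfalso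
    have h2 : (q.2 : ℝ) < 0 := by exact_mod_cast h'
    have := mul_neg_of_neg_of_pos h2 hβ
    rw [lam] at hq; linarith

/-- Transfer of separation along `m₁ (x, y) = m e + Q`, where `e` is the displacement from the
nearest candidate and `Q` the displacement between two candidates. -/
lemma pos_of_decomp {m m₁ e₁ e₂ Q₁ Q₂ x y : ℤ} {F F' : ℝ} (hm : 1 ≤ m) (hm₁ : 1 ≤ m₁)
    (hF' : 0 ≤ F') (hF : m₁ * (F' + m) ≤ F)
    (h₁ : m₁ * x = m * e₁ + Q₁) (h₂ : m₁ * y = m * e₂ + Q₂)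
    (he : (e₂ = 0 ∧ -m₁ ≤ e₁) ∨ (0 < e₂ ∧ m₁ * F' ≤ e₁))
    (hQ : (Q₂ = 0 ∧ 0 ≤ Q₁) ∨ (0 < Q₂ ∧ F ≤ Q₁)) :
    y = 0 ∨ (F' ≤ x ∧ 0 < y) := by
  have hm₁R : (1 : ℝ) ≤ m₁ := by exact_mod_cast hm₁
  have hmR : (1 : ℝ) ≤ m := by exact_mod_cast hm
  have h₁R : (m₁ : ℝ) * x = m * e₁ + Q₁ := by exact_mod_cast h₁
  have hy : 0 < m * e₂ + Q₂ → 0 < y := fun h => by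
    rw [← h₂] at h; exact pos_of_mul_pos_right h (by omega)
  have hx : m₁ * F' ≤ m * (e₁ : ℝ) + Q₁ → F' ≤ x := fun h => by
    rw [← h₁R] at h; exact le_of_mul_le_mul_left h (by linarith)
  rcases he with ⟨he, he'⟩ | ⟨he, he'⟩
  · rcases hQ with ⟨hQ, hQ'⟩ | ⟨hQ, hQ'⟩
    · left
      rw [he, hQ, mul_zero, add_zero] at h₂
      rcases mul_eq_zero.1 h₂ with h | h
      · omega
      · exact h
    · right
      refine ⟨hx ?_, hy (by rw [he]; simpa using hQ)⟩
      have : (-m₁ : ℝ) ≤ e₁ := by exact_mod_cast he'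
      nlinarith
  · right
    have hme : 0 < m * e₂ := mul_pos (by omega) he
    have hQ₁ : (0 : ℝ) ≤ Q₁ := by
      rcases hQ with ⟨_, h⟩ | ⟨_, h⟩
      · exact_mod_cast h
      · refine le_trans (le_trans ?_ hF) h; positivity
    have hQ₂ : 0 ≤ Q₂ := by rcases hQ with ⟨h, _⟩ | ⟨h, _⟩ <;> omega
    refine ⟨hx ?_, hy (by omega)⟩
    have : (0 : ℝ) ≤ m₁ * F' := by positivity
    nlinarith

/-- A multiple `b` of `D` between `b₁` and `b₂` for which `X - b β`, the first coordinate of the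
point at height `X`, keeps distance `F'` from `A₁` and from `A₂`, except that no distance is
required from the side whose second coordinate it shares. -/
lemma exists_dvd_between {β X A₁ A₂ F' : ℝ} {D : ℕ} {b₁ b₂ : ℤ} (hβ : 1 ≤ β) (hD : 0 < D)
    (hb : b₁ ≤ b₂) (h₁ : (D : ℤ) ∣ b₁) (h₂ : (D : ℤ) ∣ b₂)
    (hgap : b₁ < b₂ → 2 * F' + 1 + β * D ≤ A₂ - A₁) :
    ∃ b : ℤ, b₁ ≤ b ∧ b ≤ b₂ ∧ (D : ℤ) ∣ b ∧ (b = b₁ ∨ A₁ + F' + 1 ≤ X - b * β) ∧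
      (b = b₂ ∨ X - b * β ≤ A₂ - F') := by
  rcases hb.eq_or_lt with rfl | hlt
  · exact ⟨b₁, le_rfl, le_rfl, h₁, Or.inl rfl, Or.inl rfl⟩
  have hgap := hgap hlt
  by_cases hA : X - b₁ * β ≤ A₂ - F'
  · exact ⟨b₁, le_rfl, hb, h₁, Or.inl rfl, Or.inr hA⟩
  by_cases hB : A₁ + F' + 1 ≤ X - b₂ * β
  · exact ⟨b₂, hb, le_rfl, h₂, Or.inr hB, Or.inl rfl⟩
  push Not at hA hB
  have hβD : 0 < β * D := by positivity
  -- the least step `j` that brings `X - (b₁ + D * j) * β` down to `A₂ - F'`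
  set j : ℤ := ⌈(X - b₁ * β - (A₂ - F')) / (β * D)⌉ with hj
  have hj1 : X - b₁ * β - (A₂ - F') ≤ j * (β * D) := (div_le_iff₀ hβD).1 (Int.le_ceil _)
  have hj2 : (j - 1) * (β * D) < X - b₁ * β - (A₂ - F') := by
    rw [← lt_div_iff₀ hβD]; linarith [Int.ceil_lt_add_one ((X - b₁ * β - (A₂ - F')) / (β * D))]
  have hj0 : 0 < j := Int.ceil_pos.2 (div_pos (by linarith) hβD)
  have hcast : ((b₁ + D * j : ℤ) : ℝ) = b₁ + D * j := by push_cast; ring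
  have hlow : A₁ + F' + 1 ≤ X - ((b₁ + D * j : ℤ) : ℝ) * β := by rw [hcast]; nlinarith
  refine ⟨b₁ + D * j, ?_, ?_, dvd_add h₁ (dvd_mul_right _ _), Or.inr hlow, Or.inr ?_⟩
  · have : (0 : ℤ) ≤ D * j := by positivity
    omega
  · have : ((b₁ + D * j : ℤ) : ℝ) * β < b₂ * β := by linarith
    exact_mod_cast (lt_of_mul_lt_mul_right this (by linarith)).le
  · rw [hcast]; nlinarith

/-! ### Placing a new point -/

/-- Two candidates `P / m` and `P' / m'` for the new point have a difference which, up to the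
factor `m * m'`, is a combination of weight at most `K ^ 2`. -/
lemma Comb.cross {S : Set (ℤ × ℤ)} {K m m' : ℕ} {P P' : ℤ × ℤ} (hm : m < K) (hm' : m' < K)
    (h : Comb S (K - m) P) (h' : Comb S (K - m') P') :
    Comb S (K ^ 2) ((m' : ℤ) • P - (m : ℤ) • P') := by
  refine ((h.smul m').sub_comb (h'.smul m)).mono ?_
  obtain ⟨a, rfl⟩ := Nat.exists_eq_add_of_lt hm
  obtain ⟨b, hb⟩ := Nat.exists_eq_add_of_lt hm'
  have e1 : m + a + 1 - m = a + 1 := by omega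
  have e2 : m + a + 1 - m' = b + 1 := by omega
  rw [e1, e2]
  have h3 : (m + a + 1) ^ 2 = (m' * (a + 1) + m * (b + 1)) + ((a + 1) * (b + 1) + m * m') := by
    rw [pow_two]; nth_rewrite 2 [hb]; ring
  omega

/-- One move of Powerator: given the height `X` asked for by Challenger, there is a point `p` at
that height, up to less than `1`, which keeps all combinations of weight `K` separated, provided
that those of weight `K ^ 2` were separated with a sufficiently larger margin. -/
theorem exists_extension {β F F' X : ℝ} {K D : ℕ} {S : Set (ℤ × ℤ)} (hβ : 1 ≤ β) (hS : S.Finite)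
    (hK : 2 ≤ K) (hD : 0 < D) (hF' : 0 ≤ F')
    (hF : ((K : ℝ) - 1) ^ 2 * (2 * F' + 1 + β * D) ≤ F)
    (hdvd : ∀ q ∈ S, ((lcmUpto (K - 1) * D : ℕ) : ℤ) ∣ q.2)
    (hsep : ∀ q, Comb S (K ^ 2) q → Sep F q) (hX : 0 ≤ X) :
    ∃ p : ℤ × ℤ, 0 ≤ p.1 ∧ 0 ≤ p.2 ∧ (D : ℤ) ∣ p.2 ∧ lam β p ≤ X ∧ X < lam β p + 1 ∧
      ∀ q, Comb (insert p S) K q → Sep F' q := by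
  have hβ0 : 0 < β := by linarith
  have hKR : (2 : ℝ) ≤ K := by exact_mod_cast hK
  have hβD : 0 < β * D := by positivity
  have hF0 : 0 ≤ F := le_trans (by positivity) hF
  have hFK : (K - 1 : ℝ) * (F' + (K - 1)) ≤ F := by
    refine le_trans ?_ hF
    nlinarith [mul_nonneg (by linarith : (0 : ℝ) ≤ K - 1) hF', mul_nonneg (mul_nonneg
      (by linarith : (0 : ℝ) ≤ K - 1) (by linarith : (0 : ℝ) ≤ (K - 1) - 1)) hF',
      mul_nonneg (sq_nonneg ((K : ℝ) - 1)) (by linarith : 0 ≤ F' + β * D)]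
  have hFm : ∀ m₁ m : ℕ, m₁ < K → m < K → ((m₁ : ℤ) : ℝ) * (F' + ((m : ℤ) : ℝ)) ≤ F := by
    intro m₁ m h₁ h
    have h₁' : (m₁ : ℝ) + 1 ≤ K := by exact_mod_cast h₁
    have h' : (m : ℝ) + 1 ≤ K := by exact_mod_cast h
    refine le_trans ?_ hFK
    push_cast
    have : (0 : ℝ) ≤ m := by positivity
    exact mul_le_mul (by linarith) (by linarith) (by linarith) (by linarith)
  -- the candidates: `(m, P)` stands for the rational point `P / m`
  set C : Set (ℕ × (ℤ × ℤ)) := {c | 1 ≤ c.1 ∧ c.1 < K ∧ Comb S (K - c.1) c.2} with hC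
  have hCfin : C.Finite := by
    refine ((Set.finite_Iio K).prod (Comb.finite hS K)).subset ?_
    rintro ⟨m, P⟩ ⟨_, h2, h3⟩
    exact ⟨h2, h3.mono (Nat.sub_le _ _)⟩
  have hfrac : ∀ c ∈ C, ∃ b : ℤ, (D : ℤ) ∣ b ∧ c.2.2 = c.1 * b := by
    rintro ⟨m, P⟩ ⟨h1, h2, h3⟩
    have hml : m ∣ lcmUpto (K - 1) := Finset.dvd_lcm (f := id) (Finset.mem_Icc.2 ⟨h1, by omega⟩)
    have : ((m * D : ℕ) : ℤ) ∣ P.2 :=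
      (Int.natCast_dvd_natCast.2 (Nat.mul_dvd_mul_right hml D)).trans (h3.dvd_snd hdvd)
    obtain ⟨t, ht⟩ := this
    exact ⟨D * t, dvd_mul_right _ _, by simp only [ht]; push_cast; ring⟩
  have hpos : ∀ c ∈ C, (0 : ℝ) < c.1 := fun c hc => by exact_mod_cast hc.1
  have h10 : ((1, 0) : ℕ × (ℤ × ℤ)) ∈ C := ⟨le_rfl, hK, .zero _⟩
  have hcross : ∀ c ∈ C, ∀ c' ∈ C, lam β c.2 / c.1 ≤ lam β c'.2 / c'.1 →
      ((c.1 * c'.2.2 - c'.1 * c.2.2 = 0 ∧ 0 ≤ c.1 * c'.2.1 - c'.1 * c.2.1) ∨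
        (0 < c.1 * c'.2.2 - c'.1 * c.2.2 ∧
          F ≤ ((c.1 * c'.2.1 - c'.1 * c.2.1 : ℤ) : ℝ))) := by
    intro c hc c' hc' hle
    have := (hsep _ (Comb.cross hc'.2.1 hc.2.1 hc'.2.2 hc.2.2)).of_lam_nonneg hβ0 hF0 (by
      rw [lam_sub, lam_zsmul, lam_zsmul]
      rw [div_le_div_iff₀ (hpos c hc) (hpos c' hc')] at hle
      push_cast; linarith)
    simpa using this
  -- the nearest candidate `P₁ / m₁` below `X`
  obtain ⟨⟨m₁, P₁⟩, ⟨hc₁, hlow₁⟩, hmax⟩ := Set.exists_max_image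
    {c ∈ C | lam β c.2 / c.1 ≤ X} (fun c => lam β c.2 / c.1) (hCfin.subset (Set.sep_subset _ _))
    ⟨(1, 0), h10, by simpa [lam] using hX⟩
  obtain ⟨b₁, hDb₁, hb₁⟩ := hfrac _ hc₁
  have hm₁ := hpos _ hc₁
  simp only at hlow₁ hmax hb₁ hm₁
  have hm₁Z : (1 : ℤ) ≤ m₁ := by exact_mod_cast hc₁.1
  have hlow₁' : lam β P₁ ≤ X * m₁ := (div_le_iff₀ hm₁).1 hlow₁
  -- the second coordinate of the new point
  obtain ⟨b, hDb, hblow, hbhigh⟩ : ∃ b : ℤ, (D : ℤ) ∣ b ∧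
      (b = b₁ ∨ (b₁ < b ∧ (P₁.1 : ℝ) / m₁ + F' + 1 ≤ X - b * β)) ∧
      ∀ c ∈ C, X < lam β c.2 / c.1 → c.2.2 - c.1 * b = 0 ∨
        (F' ≤ ((c.2.1 - c.1 * ⌊X - b * β⌋ : ℤ) : ℝ) ∧ 0 < c.2.2 - c.1 * b) := by
    by_cases hne : {c ∈ C | X < lam β c.2 / c.1}.Nonempty
    · -- the nearest candidate `P₂ / m₂` above `X`
      obtain ⟨⟨m₂, P₂⟩, ⟨hc₂, hlow₂⟩, hmin⟩ := Set.exists_min_image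
        {c ∈ C | X < lam β c.2 / c.1} (fun c => lam β c.2 / c.1)
        (hCfin.subset (Set.sep_subset _ _)) hne
      obtain ⟨b₂, hDb₂, hb₂⟩ := hfrac _ hc₂
      have hm₂ := hpos _ hc₂
      simp only at hlow₂ hmin hb₂ hm₂
      have hm₂Z : (1 : ℤ) ≤ m₂ := by exact_mod_cast hc₂.1
      have hlow₂' : X * m₂ < lam β P₂ := (lt_div_iff₀ hm₂).1 hlow₂
      have h12 := hcross _ hc₁ _ hc₂ (hlow₁.trans hlow₂.le)
      simp only [hb₁, hb₂] at h12
      have hrw : (m₁ : ℤ) * (m₂ * b₂) - m₂ * (m₁ * b₁) = m₁ * m₂ * (b₂ - b₁) := by ring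
      rw [hrw] at h12
      have hmm : (0 : ℤ) < m₁ * m₂ := by positivity
      have hb12 : b₁ ≤ b₂ := by
        rcases h12 with ⟨h, _⟩ | ⟨h, _⟩
        · rcases mul_eq_zero.1 h with h | h <;> omega
        · have := pos_of_mul_pos_right h hmm.le
          omega
      obtain ⟨b, hbb₁, hbb₂, hDb, hl, hh⟩ := exists_dvd_between (X := X) (F' := F')
        (A₁ := (P₁.1 : ℝ) / m₁) (A₂ := (P₂.1 : ℝ) / m₂) hβ hD hb12 hDb₁ hDb₂ (by
          intro hlt
          rcases h12 with ⟨h, _⟩ | ⟨_, h⟩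
          · rcases mul_eq_zero.1 h with h | h <;> omega
          · rw [div_sub_div _ _ hm₂.ne' hm₁.ne', le_div_iff₀ (by positivity)]
            push_cast at h
            have e1 : (m₁ : ℝ) + 1 ≤ K := by exact_mod_cast hc₁.2.1
            have e2 : (m₂ : ℝ) + 1 ≤ K := by exact_mod_cast hc₂.2.1
            have e3 : (m₂ * m₁ : ℝ) ≤ (K - 1) ^ 2 := by
              rw [pow_two]
              exact mul_le_mul (by linarith) (by linarith) hm₁.le (by linarith)
            have e4 : (2 * F' + 1 + β * D) * (m₂ * m₁) ≤ F := by
              refine le_trans ?_ hF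
              rw [mul_comm]
              exact mul_le_mul_of_nonneg_right e3 (by positivity)
            linarith)
      refine ⟨b, hDb, ?_, ?_⟩
      · rcases hl with hl | hl
        · exact Or.inl hl
        · rcases hbb₁.eq_or_lt with h | h
          · exact Or.inl h.symm
          · exact Or.inr ⟨h, hl⟩
      · rintro ⟨m, P⟩ hc hXc
        have hmZ : (1 : ℤ) ≤ m := by exact_mod_cast hc.1
        have hQ := hcross _ hc₂ _ hc (hmin _ ⟨hc, hXc⟩)
        have hfl : (⌊X - b * β⌋ : ℝ) ≤ X - b * β := Int.floor_le _
        refine pos_of_decomp (e₁ := P₂.1 - m₂ * ⌊X - b * β⌋) (e₂ := P₂.2 - m₂ * b) hmZ hm₂Z hF'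
          (hFm _ _ hc₂.2.1 hc.2.1) ?_ ?_ ?_ hQ
        · ring
        · ring
        · rcases hbb₂.eq_or_lt with h | h
          · left
            refine ⟨by rw [hb₂, h]; ring, ?_⟩
            have h0 : (0 : ℝ) < ((P₂.1 - m₂ * ⌊X - b * β⌋ : ℤ) : ℝ) := by
              rw [lam, hb₂, ← h] at hlow₂'
              push_cast at hlow₂' ⊢
              nlinarith
            have : 0 < P₂.1 - m₂ * ⌊X - b * β⌋ := by exact_mod_cast h0
            omega
          · right
            refine ⟨?_, ?_⟩
            · rw [hb₂, ← mul_sub]; exact mul_pos (by omega) (by omega)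
            · have hh := hh.resolve_left h.ne
              have : (P₂.1 : ℝ) = m₂ * (P₂.1 / m₂) := by field_simp
              push_cast
              rw [this]
              nlinarith
    · refine ⟨b₁, hDb₁, Or.inl rfl, fun c hc hXc => (hne ⟨c, hc, hXc⟩).elim⟩
  set a : ℤ := ⌊X - b * β⌋ with ha
  have hfl : (a : ℝ) ≤ X - b * β := Int.floor_le _
  have hfl' : X - b * β < a + 1 := Int.lt_floor_add_one _
  have hp1 : lam β (a, b) ≤ X := by simp only [lam]; linarith
  have hp2 : X < lam β (a, b) + 1 := by simp only [lam]; linarith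
  have hlowall : ∀ c ∈ C, lam β c.2 / c.1 ≤ X →
      c.1 * b - c.2.2 = 0 ∨ (F' ≤ ((c.1 * a - c.2.1 : ℤ) : ℝ) ∧ 0 < c.1 * b - c.2.2) := by
    rintro ⟨m, P⟩ hc hXc
    have hmZ : (1 : ℤ) ≤ m := by exact_mod_cast hc.1
    have hQ := hcross _ hc _ hc₁ (hmax _ ⟨hc, hXc⟩)
    refine pos_of_decomp (e₁ := m₁ * a - P₁.1) (e₂ := m₁ * b - P₁.2) hmZ hm₁Z hF'
      (hFm _ _ hc₁.2.1 hc.2.1) ?_ ?_ ?_ hQ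
    · ring
    · ring
    · rcases hblow with h | ⟨h, h'⟩
      · left
        refine ⟨by rw [hb₁, h]; ring, ?_⟩
        have h0 : (-m₁ : ℝ) ≤ ((m₁ * a - P₁.1 : ℤ) : ℝ) := by
          rw [lam, hb₁, ← h] at hlow₁'
          push_cast at hlow₁' ⊢
          nlinarith
        exact_mod_cast h0
      · right
        refine ⟨?_, ?_⟩
        · rw [hb₁, ← mul_sub]; exact mul_pos (by omega) (by omega)
        · have : (P₁.1 : ℝ) = m₁ * (P₁.1 / m₁) := by field_simp
          push_cast
          rw [this]
          nlinarith
  -- the new point is separated from every candidate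
  have hall : ∀ c ∈ C, Sep F' ((c.1 : ℤ) • (a, b) - c.2) := by
    intro c hc
    rcases le_or_gt (lam β c.2 / c.1) X with h | h
    · rcases hlowall c hc h with h | ⟨h, h'⟩
      · left; simpa using h
      · right; left; exact ⟨by simpa using h, by simpa using h'⟩
    · rw [← neg_sub]
      apply Sep.neg
      rcases hbhigh c hc h with h | ⟨h, h'⟩
      · left; simpa using h
      · right; left; exact ⟨by simpa using h, by simpa using h'⟩
  -- separation from the candidate `0 / 1` also yields nonnegative coordinates
  have hp : Sep F' (a, b) := by simpa using hall _ h10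
  have hnonneg : 0 ≤ a ∧ 0 ≤ b := by
    rcases hp with h | ⟨h, h'⟩ | ⟨h, h'⟩
    · simp only at h
      refine ⟨Int.floor_nonneg.2 (by rw [h]; simpa using hX), h.ge⟩
    · exact ⟨by exact_mod_cast hF'.trans h, h'.le⟩
    · exfalso
      simp only at h h'
      have : (b : ℝ) ≤ -1 := by exact_mod_cast Int.le_sub_one_of_lt h'
      nlinarith
  refine ⟨(a, b), hnonneg.1, hnonneg.2, hDb, hp1, hp2, fun q hq => ?_⟩
  obtain ⟨m, j, P, hP, hmj, rfl⟩ := hq.of_insert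
  have hKF : F' ≤ F := le_trans (by nlinarith) hFK
  have hwt : ∀ (n j : ℕ) (P : ℤ × ℤ), 1 ≤ n → Comb S j P → n + j ≤ K →
      Sep F' ((n : ℤ) • (a, b) - P) := by
    intro n j P hn hP hnj
    by_cases hnK : n < K
    · exact hall (n, P) ⟨hn, hnK, hP.mono (by omega)⟩
    -- weight `K` on the new point alone: a multiple of `p`, which is separated from `0`
    · obtain rfl : j = 0 := by omega
      rw [hP.eq_zero, sub_zero]
      have hn0 : (1 : ℝ) ≤ n := by exact_mod_cast hn
      have hnZ : (0 : ℤ) < n := by exact_mod_cast hn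
      rcases hp with h | ⟨h, h'⟩ | ⟨h, h'⟩
      · left; simpa using Or.inr h
      · right; left
        refine ⟨?_, by simpa using mul_pos hnZ h'⟩
        simp only at h
        simp only [Prod.smul_mk, smul_eq_mul]; push_cast; nlinarith
      · right; right
        refine ⟨?_, by simpa using mul_neg_of_pos_of_neg hnZ h'⟩
        simp only at h
        simp only [Prod.smul_mk, smul_eq_mul]; push_cast; nlinarith
  rcases lt_trichotomy m 0 with hm | rfl | hm
  · have := (hwt m.natAbs j P (by omega) hP hmj).neg
    rw [Int.natCast_natAbs, abs_of_neg hm, neg_sub, neg_smul, sub_neg_eq_add, add_comm] at this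
    exact this
  · rw [zero_smul, zero_add]
    refine (hsep P (hP.mono ?_)).mono hKF
    exact le_trans (by omega) (Nat.le_self_pow two_ne_zero K)
  · have := hwt m.natAbs j (-P) (by omega) hP.neg hmj
    rw [Int.natCast_natAbs, abs_of_pos hm, sub_neg_eq_add] at this
    exact this

/-! ### The least common multiple of an initial segment -/

lemma lcmUpto_mul_dvd {a b : ℕ} (ha : a ≠ 0) (hb : b ≠ 0) :
    lcmUpto a * lcmUpto b ∣ lcmUpto (a * b) := by
  rw [← Nat.factorization_le_iff_dvd (mul_ne_zero (Nat.lcmUpto_ne_zero _) (Nat.lcmUpto_ne_zero _))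
    (Nat.lcmUpto_ne_zero _), Nat.factorization_mul (Nat.lcmUpto_ne_zero _) (Nat.lcmUpto_ne_zero _)]
  intro p
  by_cases hp : p.Prime
  · rw [Finsupp.add_apply, Nat.factorization_lcmUpto _ hp, Nat.factorization_lcmUpto _ hp,
      Nat.factorization_lcmUpto _ hp]
    refine Nat.le_log_of_pow_le hp.one_lt ?_
    rw [pow_add]
    exact Nat.mul_le_mul (Nat.pow_log_le_self p ha) (Nat.pow_log_le_self p hb)
  · simp [Nat.factorization_eq_zero_of_not_prime _ hp]

lemma lcmUpto_mono_dvd {a b : ℕ} (h : a ≤ b) : lcmUpto a ∣ lcmUpto b :=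
  Finset.lcm_dvd fun _ hx => Finset.dvd_lcm (f := id)
    (Finset.Icc_subset_Icc_right h hx)

lemma lcmUpto_mono {a b : ℕ} (h : a ≤ b) : lcmUpto a ≤ lcmUpto b :=
  Nat.le_of_dvd (Nat.lcmUpto_pos _) (lcmUpto_mono_dvd h)

lemma log_eq_sum_ite {p n b : ℕ} (hp : 1 < p) (hn : n ≠ 0) (hb : p.log n < b) :
    p.log n = ∑ i ∈ Finset.Ico 1 b, if p ^ i ≤ n then 1 else 0 := by
  rw [← Finset.sum_filter, Finset.sum_const, smul_eq_mul, mul_one]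
  have : (Finset.Ico 1 b).filter (fun i => p ^ i ≤ n) = Finset.Icc 1 (p.log n) := by
    ext i
    simp only [Finset.mem_filter, Finset.mem_Ico, Finset.mem_Icc]
    rw [← Nat.le_log_iff_pow_le hp hn]
    omega
  rw [this, Nat.card_Icc, Nat.add_sub_cancel]

/-- At each prime power `q`, the claim is
`[1 ≤ X] + ⌊X / 2⌋ + ⌊X / 3⌋ + ⌊X / 6⌋ ≤ [6 ≤ X] + X` for `X = ⌊6 M / q⌋`. -/
lemma lcmUpto_six_mul_dvd (M : ℕ) :
    lcmUpto (6 * M) * ((3 * M)! * ((2 * M)! * M !)) ∣ lcmUpto M * (6 * M)! := by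
  rcases Nat.eq_zero_or_pos M with rfl | hM
  · simp
  have h1 := Nat.lcmUpto_ne_zero (6 * M)
  have h2 := Nat.lcmUpto_ne_zero M
  have f1 := Nat.factorial_ne_zero (3 * M)
  have f2 := Nat.factorial_ne_zero (2 * M)
  have f3 := Nat.factorial_ne_zero M
  have f4 := Nat.factorial_ne_zero (6 * M)
  rw [← Nat.factorization_le_iff_dvd (by positivity) (by positivity),
    Nat.factorization_mul h1 (by positivity), Nat.factorization_mul f1 (by positivity),
    Nat.factorization_mul f2 f3, Nat.factorization_mul h2 f4]
  intro p
  by_cases hp : p.Prime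
  swap
  · simp [Nat.factorization_eq_zero_of_not_prime _ hp]
  obtain ⟨b, hb⟩ := exists_gt (p.log (6 * M))
  have hlog : ∀ n ≤ 6 * M, p.log n < b := fun n hn => (Nat.log_mono_right hn).trans_lt hb
  simp only [Finsupp.add_apply, Nat.factorization_lcmUpto _ hp]
  rw [Nat.factorization_factorial hp (hlog (3 * M) (by omega)),
    Nat.factorization_factorial hp (hlog (2 * M) (by omega)),
    Nat.factorization_factorial hp (hlog M (by omega)),
    Nat.factorization_factorial hp (hlog (6 * M) le_rfl),
    log_eq_sum_ite hp.one_lt (by omega) (hlog (6 * M) le_rfl),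
    log_eq_sum_ite hp.one_lt (by omega) (hlog M (by omega)),
    ← Finset.sum_add_distrib, ← Finset.sum_add_distrib, ← Finset.sum_add_distrib,
    ← Finset.sum_add_distrib]
  refine Finset.sum_le_sum fun i _ => ?_
  have hq : 0 < p ^ i := pow_pos hp.pos i
  have e (c d : ℕ) (hc : 0 < c) : d * M / p ^ i = c * d * M / p ^ i / c := by
    rw [Nat.div_div_eq_div_mul, mul_comm (p ^ i) c, mul_assoc, Nat.mul_div_mul_left _ _ hc]
  have e3 := e 2 3 (by norm_num)
  have e2 := e 3 2 (by norm_num)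
  have e1 := e 6 1 (by norm_num)
  norm_num at e3 e2 e1
  have i1 : p ^ i ≤ 6 * M ↔ 1 ≤ 6 * M / p ^ i := by
    rw [Nat.le_div_iff_mul_le hq, one_mul]
  have i2 : p ^ i ≤ M ↔ 1 ≤ M / p ^ i := by
    rw [Nat.le_div_iff_mul_le hq, one_mul]
  simp only [i1, i2, e3, e2, e1]
  generalize 6 * M / p ^ i = X
  split_ifs <;> omega

/-- A bound for the multinomial coefficient `(6M)! / ((3M)! (2M)! M!)`;
`432 = 2 ^ 3 * 3 ^ 2 * 6`. -/
lemma factorial_six_mul_le (M : ℕ) :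
    (6 * M)! ≤ 432 ^ M * ((3 * M)! * ((2 * M)! * M !)) := by
  induction M with
  | zero => simp
  | succ M ih =>
    have e6 : (6 * (M + 1))! = (6 * M + 6) * (6 * M + 5) * (6 * M + 4) * (6 * M + 3) * (6 * M + 2) *
        (6 * M + 1) * (6 * M)! := by
      rw [show 6 * (M + 1) = 6 * M + 6 by ring]; simp only [Nat.factorial_succ]; ring
    have e3 : (3 * (M + 1))! = (3 * M + 3) * (3 * M + 2) * (3 * M + 1) * (3 * M)! := by
      rw [show 3 * (M + 1) = 3 * M + 3 by ring]; simp only [Nat.factorial_succ]; ring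
    have e2 : (2 * (M + 1))! = (2 * M + 2) * (2 * M + 1) * (2 * M)! := by
      rw [show 2 * (M + 1) = 2 * M + 2 by ring]; simp only [Nat.factorial_succ]; ring
    rw [e6, e3, e2, Nat.factorial_succ]
    calc (6 * M + 6) * (6 * M + 5) * (6 * M + 4) * (6 * M + 3) * (6 * M + 2) * (6 * M + 1) *
          (6 * M)!
        ≤ (6 * M + 6) * (6 * M + 6) * (6 * M + 4) * (6 * M + 3) * (6 * M + 2) * (6 * M + 6) *
          (432 ^ M * ((3 * M)! * ((2 * M)! * M !))) := by gcongr <;> omega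
      _ = _ := by ring

lemma lcmUpto_six_mul_le (M : ℕ) : lcmUpto (6 * M) ≤ 432 ^ M * lcmUpto M := by
  have hpos : 0 < (3 * M)! * ((2 * M)! * M !) := by positivity
  refine Nat.le_of_mul_le_mul_right ?_ hpos
  calc lcmUpto (6 * M) * ((3 * M)! * ((2 * M)! * M !)) ≤ lcmUpto M * (6 * M)! :=
        Nat.le_of_dvd (Nat.mul_pos (Nat.lcmUpto_pos _) (Nat.factorial_pos _))
          (lcmUpto_six_mul_dvd M)
    _ ≤ lcmUpto M * (432 ^ M * ((3 * M)! * ((2 * M)! * M !))) :=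
        Nat.mul_le_mul_left _ (factorial_six_mul_le M)
    _ = _ := by ring

lemma lcmUpto_le_four_pow (n : ℕ) : lcmUpto n ≤ 4 ^ n := by
  induction n using Nat.strong_induction_on with
  | _ n ih =>
    -- `⌈n / 6⌉ ≥ 9` makes up for rounding `n` up to a multiple of `6`
    rcases lt_or_ge n 49 with hn | hn
    · have : ∀ n < 49, lcmUpto n ≤ 4 ^ n := by decide +kernel
      exact this n hn
    · obtain ⟨M, hM1, hM2⟩ : ∃ M, n ≤ 6 * M ∧ 6 * M ≤ n + 5 := ⟨(n + 5) / 6, by omega, by omega⟩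
      obtain ⟨j, rfl⟩ := Nat.exists_eq_add_of_le (by omega : 9 ≤ M)
      calc lcmUpto n ≤ lcmUpto (6 * (9 + j)) := lcmUpto_mono hM1
        _ ≤ 432 ^ (9 + j) * lcmUpto (9 + j) := lcmUpto_six_mul_le _
        _ ≤ 432 ^ (9 + j) * 4 ^ (9 + j) := Nat.mul_le_mul_left _ (ih _ (by omega))
        _ = 1728 ^ 9 * 1728 ^ j := by rw [← mul_pow, ← pow_add]; norm_num
        _ ≤ 4 ^ 49 * 4096 ^ j := Nat.mul_le_mul (by norm_num) (Nat.pow_le_pow_left (by norm_num) _)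
        _ = 4 ^ (49 + 6 * j) := by rw [pow_add, pow_mul]; norm_num
        _ ≤ 4 ^ n := Nat.pow_le_pow_right (by norm_num) (by omega)

lemma lcmUpto_six_mul_le_pow (M : ℕ) : lcmUpto (6 * M) ≤ 12 ^ (3 * M) :=
  calc lcmUpto (6 * M) ≤ 432 ^ M * 4 ^ M :=
        (lcmUpto_six_mul_le M).trans (Nat.mul_le_mul_left _ (lcmUpto_le_four_pow M))
    _ = 12 ^ (3 * M) := by rw [← mul_pow, pow_mul]; norm_num

/-! ### Moduli and margins -/

/-- With `k` rounds to go, all exponents of `v` are multiples of `modulus k`: they remain integers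
after the divisions by numbers less than `3 ^ 2 ^ j`, one for each `j < k`, which the `k` rounds
may require. -/
def modulus : ℕ → ℕ
  | 0 => 1
  | k + 1 => lcmUpto (3 ^ 2 ^ k - 1) * modulus k

/-- With `k` rounds to go, combinations of weight at most `3 ^ 2 ^ k` are separated with margin
`marginCoeff k * log v`. -/
def marginCoeff : ℕ → ℕ
  | 0 => 0
  | k + 1 => (3 ^ 2 ^ k - 1) ^ 2 * (2 * marginCoeff k + 1 + modulus k)

lemma modulus_pos (k : ℕ) : 0 < modulus k := by
  induction k with
  | zero => simp [modulus]
  | succ k ih => exact Nat.mul_pos (Nat.lcmUpto_pos _) ih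

/-- This uses `∏ 3 ^ 2 ^ j = 3 ^ (2 ^ k - 1)`, the product being over `j < k`. -/
lemma modulus_dvd_lcmUpto (k : ℕ) : modulus k ∣ lcmUpto (3 ^ (2 ^ k - 1)) := by
  induction k with
  | zero => simp [modulus]
  | succ k ih =>
    have h2 : 1 ≤ 2 ^ k := Nat.one_le_two_pow
    have : 3 ^ (2 ^ (k + 1) - 1) = 3 ^ 2 ^ k * 3 ^ (2 ^ k - 1) := by
      rw [← pow_add]; congr 1; rw [pow_succ]; omega
    rw [this, modulus]
    exact (mul_dvd_mul (lcmUpto_mono_dvd (Nat.sub_le _ _)) ih).trans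
      (lcmUpto_mul_dvd (by positivity) (by positivity))

lemma modulus_succ_le (k : ℕ) : modulus (k + 1) ≤ 4 ^ (2 * 3 ^ 2 ^ k) := by
  induction k with
  | zero => decide +kernel
  | succ k ih =>
    have h3 : 3 ^ 2 ^ k * 3 ≤ 3 ^ 2 ^ (k + 1) := by
      rw [pow_succ 2, pow_mul, pow_two]
      exact Nat.mul_le_mul_left _ (Nat.le_self_pow (by positivity) 3)
    calc modulus (k + 2) ≤ 4 ^ (3 ^ 2 ^ (k + 1) - 1) * 4 ^ (2 * 3 ^ 2 ^ k) :=
          Nat.mul_le_mul (lcmUpto_le_four_pow _) ih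
      _ ≤ 4 ^ (2 * 3 ^ 2 ^ (k + 1)) := by
          rw [← pow_add]; exact Nat.pow_le_pow_right (by norm_num) (by omega)

lemma marginCoeff_le_of_le_three {n : ℕ} (hn : n ≤ 3) : marginCoeff n ≤ 10 ^ 8 := by
  have : ∀ n ≤ 3, marginCoeff n ≤ 10 ^ 8 := by decide +kernel
  exact this n hn

lemma pow_eight_le_four_pow {s : ℕ} (hs : 16 ≤ s) : s ^ 8 ≤ 4 ^ s := by
  have h : s ^ 4 ≤ 2 ^ s := by
    induction s, hs using Nat.le_induction with
    | base => norm_num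
    | succ s hs ih =>
      rw [pow_succ 2]
      refine le_trans ?_ (Nat.mul_le_mul_right 2 ih)
      have h1 : 16 * s ^ 3 ≤ s ^ 4 := by rw [pow_succ s 3, mul_comm]; gcongr
      nlinarith [pow_pos (by omega : 0 < s) 3, pow_pos (by omega : 0 < s) 2,
        mul_le_mul_right hs (s ^ 2), mul_le_mul_right hs s]
  calc s ^ 8 = (s ^ 4) ^ 2 := by ring
    _ ≤ (2 ^ s) ^ 2 := Nat.pow_le_pow_left h 2
    _ = 4 ^ s := by rw [← pow_mul, mul_comm, pow_mul]; norm_num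

/-- The induction step for the bound on `marginCoeff`, with `s = 3 ^ 2 ^ (k + 2)`; the power of
`12` bounds `lcmUpto (s ^ 2 - 1)`, where `M` is about `s ^ 2 / 6`. -/
lemma marginCoeff_step {s M : ℕ} (hs : 81 ≤ s) (hM : 6 * M ≤ s ^ 2 + 6) :
    (s ^ 4) ^ 2 * (2 * 4 ^ s + 1 + 12 ^ (3 * M) * 4 ^ (2 * s)) ≤ 4 ^ s ^ 2 := by
  have h1 : 2 * 4 ^ s + 1 + 12 ^ (3 * M) * 4 ^ (2 * s) ≤ 2 * (12 ^ (3 * M) * 4 ^ (2 * s)) := by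
    have : 2 * 4 ^ s + 1 ≤ 4 ^ (2 * s) := by
      have h4 : 4 ≤ 4 ^ s := Nat.le_self_pow (by omega) 4
      rw [two_mul s, pow_add]; nlinarith
    have h12 : 1 ≤ 12 ^ (3 * M) := Nat.one_le_pow _ _ (by norm_num)
    linarith [Nat.le_mul_of_pos_left (4 ^ (2 * s)) h12]
  have h2 : 4 ^ (6 * s + 1) * 12 ^ (s ^ 2 + 6) ≤ 16 ^ s ^ 2 := by
    obtain ⟨t, ht⟩ : ∃ t, s ^ 2 = 5 * t + s ^ 2 % 5 := ⟨s ^ 2 / 5, by omega⟩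
    have ht' : 6 * s + 12 ≤ t := by nlinarith [Nat.mod_lt (s ^ 2) (by norm_num : 0 < 5)]
    calc 4 ^ (6 * s + 1) * 12 ^ (s ^ 2 + 6) = 4 ^ (6 * s + 1) * 12 ^ 6 * 12 ^ s ^ 2 := by
          rw [pow_add 12]; ring
      _ ≤ 4 ^ (6 * s + 1) * 4 ^ 11 * 12 ^ s ^ 2 :=
          Nat.mul_le_mul_right _ (Nat.mul_le_mul_left _ (by norm_num))
      _ = 4 ^ (6 * s + 12) * 12 ^ s ^ 2 := by rw [← pow_add]
      _ ≤ 4 ^ t * 12 ^ s ^ 2 := by gcongr; norm_num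
      _ = 4 ^ t * 12 ^ (5 * t) * 12 ^ (s ^ 2 % 5) := by rw [ht, pow_add 12]; simp [mul_assoc]
      _ ≤ 16 ^ (5 * t) * 16 ^ (s ^ 2 % 5) := by
          refine Nat.mul_le_mul ?_ (Nat.pow_le_pow_left (by norm_num) _)
          rw [pow_mul, pow_mul, ← mul_pow]
          exact Nat.pow_le_pow_left (by norm_num) _
      _ = 16 ^ s ^ 2 := by rw [← pow_add, ← ht]
  -- squaring turns `3 * M` into `6 * M`, which can be compared with `s ^ 2`
  refine (Nat.pow_le_pow_iff_left two_ne_zero).1 ?_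
  calc ((s ^ 4) ^ 2 * (2 * 4 ^ s + 1 + 12 ^ (3 * M) * 4 ^ (2 * s))) ^ 2
      ≤ (4 ^ s * (2 * (12 ^ (3 * M) * 4 ^ (2 * s)))) ^ 2 := by
        refine Nat.pow_le_pow_left (Nat.mul_le_mul ?_ h1) 2
        rw [← pow_mul]; exact pow_eight_le_four_pow (by omega)
    _ = 4 ^ (6 * s + 1) * 12 ^ (6 * M) := by
        rw [pow_succ 4 (6 * s), show 6 * s = s * 2 + 2 * s * 2 by ring, pow_add,
          pow_mul 4 s, pow_mul 4 (2 * s), show 6 * M = 3 * M * 2 by ring, pow_mul 12 (3 * M)]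
        generalize 12 ^ (3 * M) = x
        ring
    _ ≤ 4 ^ (6 * s + 1) * 12 ^ (s ^ 2 + 6) :=
        Nat.mul_le_mul_left _ (Nat.pow_le_pow_right (by norm_num) hM)
    _ ≤ 16 ^ s ^ 2 := h2
    _ = (4 ^ s ^ 2) ^ 2 := by rw [← pow_mul, mul_comm, pow_mul]; norm_num

lemma marginCoeff_add_four_le (k : ℕ) : marginCoeff (k + 4) ≤ 4 ^ 3 ^ 2 ^ (k + 2) := by
  induction k with
  | zero => decide +kernel
  | succ k ih =>
    set s := 3 ^ 2 ^ (k + 2) with hs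
    have hsq : 3 ^ 2 ^ (k + 3) = s ^ 2 := by rw [hs, ← pow_mul, ← pow_succ]
    have hsq4 : 3 ^ 2 ^ (k + 4) = s ^ 4 := by rw [hs, ← pow_mul]; congr 1; ring
    have hs81 : 81 ≤ s := by
      calc 81 = 3 ^ 2 ^ 2 := by norm_num
        _ ≤ s := Nat.pow_le_pow_right (by norm_num) (Nat.pow_le_pow_right (by norm_num) (by omega))
    have hM : s ^ 2 - 1 ≤ 6 * (s ^ 2 / 6 + 1) := by omega
    have hmod : modulus (k + 4) ≤ 12 ^ (3 * (s ^ 2 / 6 + 1)) * 4 ^ (2 * s) := by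
      refine Nat.mul_le_mul ?_ (modulus_succ_le (k + 2))
      rw [hsq]
      exact (lcmUpto_mono hM).trans (lcmUpto_six_mul_le_pow _)
    calc marginCoeff (k + 5) ≤ (s ^ 4) ^ 2 * (2 * 4 ^ s + 1 +
          12 ^ (3 * (s ^ 2 / 6 + 1)) * 4 ^ (2 * s)) := by
          rw [marginCoeff, hsq4]
          gcongr
          exact Nat.sub_le _ _
      _ ≤ 4 ^ s ^ 2 := marginCoeff_step hs81 (by omega)
      _ = 4 ^ 3 ^ 2 ^ (k + 3) := by rw [hsq]

/-! ### Powerator's strategy -/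

lemma Strategy.isPlay_cons {σ : Strategy} {us ws : List ℕ} {u : ℕ}
    (h : LegalResponse (σ.move us) u) (h' : σ.IsPlay (us ++ [u]) ws) : σ.IsPlay us (u :: ws) := by
  rintro ⟨i, hi⟩
  cases i with
  | zero => simpa using h
  | succ i => simpa using h' ⟨i, by simpa using hi⟩

lemma logb_two_pow_mul_pow {v : ℕ} (hv : 1 < v) (a b : ℕ) :
    Real.logb 2 ((2 ^ a * v ^ b : ℕ) : ℝ) = a + b * Real.logb 2 v := by
  have hv0 : (v : ℝ) ≠ 0 := by positivity
  push_cast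
  rw [Real.logb_mul (by positivity) (by positivity), Real.logb_pow, Real.logb_pow,
    Real.logb_self_eq_one (by norm_num), mul_one]

lemma one_le_logb_two {v : ℕ} (hv : 1 < v) : 1 ≤ Real.logb 2 v := by
  rw [Real.le_logb_iff_rpow_le (by norm_num) (by positivity), Real.rpow_one]
  exact_mod_cast hv

/-- A position made of points whose combinations of weight `3` are separated is not won by
Challenger: a separated combination does not have height in `(0, 1)`. -/
lemma not_challengerWins {β : ℝ} (hβ : 1 ≤ β) {us : List ℕ} {S : Set (ℤ × ℤ)}
    (hus : ∀ u ∈ us, 0 < u ∧ ∃ q ∈ S, Real.logb 2 u = lam β q)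
    (hsep : ∀ q, Comb S 3 q → Sep 0 q) : ¬ChallengerWins us := by
  rintro ⟨h, i, j, h₁, h₂⟩
  obtain ⟨hh0, p, hp, hph⟩ := hus _ (us.get_mem h)
  obtain ⟨hi0, q, hq, hqi⟩ := hus _ (us.get_mem i)
  obtain ⟨hj0, r, hr, hrj⟩ := hus _ (us.get_mem j)
  generalize us.get h = x at *
  generalize us.get i = y at *
  generalize us.get j = z at *
  have hx : (0 : ℝ) < x := by exact_mod_cast hh0
  have hy : (0 : ℝ) < y := by exact_mod_cast hi0
  have hz : (0 : ℝ) < z := by exact_mod_cast hj0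
  have l₁ : Real.logb 2 (y * z) < Real.logb 2 x :=
    Real.logb_lt_logb (by norm_num) (by positivity) (by exact_mod_cast h₁)
  have l₂ : Real.logb 2 x < Real.logb 2 (2 * (y * z)) :=
    Real.logb_lt_logb (by norm_num) hx (by exact_mod_cast h₂)
  rw [Real.logb_mul (by norm_num) (by positivity), Real.logb_self_eq_one (by norm_num)] at l₂
  rw [Real.logb_mul hy.ne' hz.ne'] at l₁ l₂
  have hlam : lam β (p - q - r) = Real.logb 2 x - Real.logb 2 y - Real.logb 2 z := by
    rw [lam_sub, lam_sub, hph, hqi, hrj]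
  have hpos : 0 < lam β (p - q - r) := by rw [hlam]; linarith
  have hlt : lam β (p - q - r) < 1 := by rw [hlam]; linarith
  have hs := hsep (p - q - r) (((Comb.of_mem hp).sub hq).sub hr)
  rcases hs.of_lam_nonneg (by linarith) le_rfl hpos.le with ⟨h, _⟩ | ⟨h, h'⟩
  · rw [lam, h] at hpos hlt
    have e₁ : (0 : ℝ) < ((p - q - r).1 : ℤ) := by simpa using hpos
    have e₂ : (((p - q - r).1 : ℤ) : ℝ) < 1 := by simpa using hlt
    have e₃ : 0 < (p - q - r).1 := by exact_mod_cast e₁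
    have e₄ : (p - q - r).1 < 1 := by exact_mod_cast e₂
    omega
  · have : (1 : ℝ) ≤ ((p - q - r).2 : ℤ) := by exact_mod_cast h
    rw [lam] at hlt
    nlinarith

/-- Powerator survives `k` more rounds from a position of points `2 ^ a * v ^ b` in which `b` is
always a multiple of `modulus k` and the combinations of weight `3 ^ 2 ^ k` are separated. -/
theorem not_hasWinningStrategy_of_sep {v : ℕ} (hv : 1 < v) (k : ℕ) :
    ∀ (us : List ℕ) (S : Set (ℤ × ℤ)), S.Finite →
      (∀ u ∈ us, 0 < u ∧ ∃ q ∈ S, Real.logb 2 u = lam (Real.logb 2 v) q) →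
      (∀ q ∈ S, (modulus k : ℤ) ∣ q.2) →
      (∀ q, Comb S (3 ^ 2 ^ k) q → Sep (Real.logb 2 v * marginCoeff k) q) →
      ∀ σ : Strategy, ∃ ws : List ℕ, ws.length = k ∧ σ.IsPlay us ws ∧
        ¬ChallengerWins (us ++ ws) := by
  have hβ := one_le_logb_two hv
  set β := Real.logb 2 v with hβdef
  induction k with
  | zero =>
    intro us S _ hus _ hsep σ
    refine ⟨[], rfl, fun i => i.elim0, ?_⟩
    rw [List.append_nil]
    exact not_challengerWins hβ hus (by simpa [marginCoeff] using hsep)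
  | succ k ih =>
    intro us S hS hus hdvd hsep σ
    have hx : 0 < σ.move us := σ.move_pos us
    have hx1 : (1 : ℝ) ≤ σ.move us := by exact_mod_cast hx
    have hK : 3 ^ 2 ^ (k + 1) = (3 ^ 2 ^ k) ^ 2 := by rw [← pow_mul, ← pow_succ]
    have hK1 : 1 ≤ 3 ^ 2 ^ k := Nat.one_le_pow _ _ (by norm_num)
    obtain ⟨p, hp1, hp2, hpD, hpX, hXp, hp⟩ := exists_extension (X := Real.logb 2 (σ.move us))
      (F := β * marginCoeff (k + 1)) (F' := β * marginCoeff k) (K := 3 ^ 2 ^ k)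
      (D := modulus k) hβ hS
      (le_trans (by norm_num) (Nat.le_self_pow (n := 2 ^ k) (by positivity) 3))
      (modulus_pos k) (by positivity) (by
        rw [marginCoeff]
        push_cast [hK1]
        have : (0 : ℝ) ≤ (3 ^ 2 ^ k - 1) ^ 2 := sq_nonneg _
        nlinarith) hdvd (by rwa [hK] at hsep) (Real.logb_nonneg (by norm_num) hx1)
    set u : ℕ := 2 ^ p.1.toNat * v ^ p.2.toNat with hu
    have hu0 : 0 < u := by positivity
    have hu0R : (0 : ℝ) < u := by exact_mod_cast hu0
    have hulog : Real.logb 2 u = lam β p := by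
      rw [hu, logb_two_pow_mul_pow hv, lam]
      congr 2
      · exact_mod_cast Int.toNat_of_nonneg hp1
      · exact_mod_cast Int.toNat_of_nonneg hp2
    have hlegal : LegalResponse (σ.move us) u := by
      refine ⟨hu0, ?_, ?_⟩
      · rw [← hulog] at hpX
        exact_mod_cast (Real.logb_le_logb (by norm_num) hu0R (by linarith)).1 hpX
      · have h2 : Real.logb 2 (σ.move us) < Real.logb 2 (2 * u) := by
          rw [Real.logb_mul (by norm_num) hu0R.ne', Real.logb_self_eq_one (by norm_num), hulog]
          linarith
        exact_mod_cast (Real.logb_lt_logb_iff (by norm_num) (by linarith) (by positivity)).1 h2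
    obtain ⟨ws, hws, hplay, hwin⟩ := ih (us ++ [u]) (insert p S) (hS.insert p) (by
        intro w hw
        rcases List.mem_append.1 hw with hw | hw
        · obtain ⟨h0, q, hq, hq'⟩ := hus w hw
          exact ⟨h0, q, Or.inr hq, hq'⟩
        · rw [List.mem_singleton.1 hw]
          exact ⟨hu0, p, Or.inl rfl, hulog⟩) (by
        rintro q (rfl | hq)
        · exact hpD
        · exact (Int.natCast_dvd_natCast.2 (Dvd.intro_left _ rfl)).trans (hdvd q hq)) hp σ
    exact ⟨u :: ws, by simp [hws], σ.isPlay_cons hlegal hplay, by simpa using hwin⟩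

/-- Powerator survives `n` rounds from `2 ^ l * v ^ r` if every `d ≤ 3 ^ (2 ^ n - 1)` divides `r`
and `l / log v` is large. -/
theorem not_hasWinningStrategy {l v r n : ℕ} (hv : 1 < v) (hr : 0 < r)
    (hl : (10 : ℝ) ^ 8 ≤ l / Real.logb 2 v)
    (hdvd : ∀ d : ℕ, 0 < d → d ≤ 3 ^ (2 ^ n - 1) → d ∣ r)
    (hln : 4 ≤ n → (4 : ℝ) ^ 3 ^ 2 ^ (n - 2) ≤ l / Real.logb 2 v) :
    ¬HasWinningStrategy [2 ^ l * v ^ r] n := by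
  rintro ⟨σ, hσ⟩
  have hβ := one_le_logb_two hv
  have hmargin : Real.logb 2 v * marginCoeff n ≤ l := by
    rw [mul_comm, ← le_div_iff₀ (by linarith)]
    rcases le_or_gt n 3 with hn | hn
    · exact le_trans (by exact_mod_cast marginCoeff_le_of_le_three hn) hl
    · obtain ⟨k, rfl⟩ := Nat.exists_eq_add_of_le' (show 4 ≤ n from hn)
      exact le_trans (by exact_mod_cast marginCoeff_add_four_le k) (hln hn)
  have hmod : modulus n ∣ r := (modulus_dvd_lcmUpto n).trans
    (Finset.lcm_dvd fun d hd => hdvd d (Finset.mem_Icc.1 hd).1 (Finset.mem_Icc.1 hd).2)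
  obtain ⟨ws, hws, hplay, hwin⟩ := not_hasWinningStrategy_of_sep hv n [2 ^ l * v ^ r]
    {((l : ℤ), (r : ℤ))} (Set.finite_singleton _) (by
      intro u hu
      rw [List.mem_singleton.1 hu]
      exact ⟨by positivity, _, rfl, by rw [logb_two_pow_mul_pow hv]; simp [lam]⟩) (by
      rintro q rfl
      exact Int.natCast_dvd_natCast.2 hmod) (by
      intro q hq
      rw [← insert_empty_eq] at hq
      obtain ⟨m, j, P, hP, -, rfl⟩ := hq.of_insert
      have hP0 : P = 0 := by
        cases hP with
        | zero => rfl
        | add _ h => exact h.elim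
        | sub _ h => exact h.elim
      rw [hP0, add_zero]
      have hrZ : (0 : ℤ) < r := by exact_mod_cast hr
      have hl0 : (0 : ℝ) ≤ l := by positivity
      rcases lt_trichotomy m 0 with hm | rfl | hm
      · right; right
        have hm' : (m : ℝ) ≤ -1 := by exact_mod_cast Int.le_sub_one_of_lt hm
        refine ⟨?_, by simpa using mul_neg_of_neg_of_pos hm hrZ⟩
        simp only [Prod.smul_mk, smul_eq_mul]; push_cast; nlinarith
      · left; simp
      · right; left
        have hm' : (1 : ℝ) ≤ m := by exact_mod_cast hm
        refine ⟨?_, by simpa using mul_pos hm hrZ⟩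
        simp only [Prod.smul_mk, smul_eq_mul]; push_cast; nlinarith) σ
  exact hwin (hσ ws hws hplay)

/-! ### The bounds in terms of logarithms -/

lemma log_eq_logb {x : ℝ} (hx : 1 < x) : log x = Real.logb 2 x := if_neg hx.not_ge

lemma two_pow_le_of_le_log {n : ℕ} (hn : n ≠ 0) {x : ℝ} (h : (n : ℝ) ≤ log x) :
    (2 : ℝ) ^ n ≤ x := by
  have hn' : (0 : ℝ) < n := by positivity
  have hx : 1 < x := by
    by_contra hx
    rw [log, if_pos (not_lt.1 hx)] at h
    linarith
  rw [log_eq_logb hx, Real.le_logb_iff_rpow_le (by norm_num) (by linarith)] at h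
  exact_mod_cast h

/-- The lower bound on the complexity, for any family `f` of bounds such that `n < f d` forces
`d > 3 ^ (2 ^ n - 1)`. -/
theorem sInf_le_complexity {l v r : ℕ} (hv : 1 < v) (hr : 0 < r)
    (hl : (10 : ℝ) ^ 8 ≤ (l : ℝ) / log v) (f : ℕ → ℕ)
    (hf : ∀ n d : ℕ, n ≠ 0 → n < f d → 3 ^ (2 ^ n - 1) < d) :
    ((sInf ({k : ℕ | ∃ d : ℕ, 0 < d ∧ ¬ d ∣ r ∧ k = f d} ∪
      {⌊log (Real.logb 3 (Real.logb 4 ((l : ℝ) / log v)))⌋₊ + 3}) : ℕ) : ℕ∞) ≤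
        complexity [2 ^ l * v ^ r] := by
  rw [log_eq_logb (x := (v : ℝ)) (by exact_mod_cast hv)] at hl ⊢
  set s : ℕ := sInf ({k : ℕ | ∃ d : ℕ, 0 < d ∧ ¬ d ∣ r ∧ k = f d} ∪
      {⌊log (Real.logb 3 (Real.logb 4 ((l : ℝ) / Real.logb 2 v)))⌋₊ + 3}) with hs
  refine le_sInf ?_
  rintro _ ⟨n, rfl, hn⟩
  by_contra hlt
  have hlt : n < s := by exact_mod_cast not_le.1 hlt
  refine not_hasWinningStrategy hv hr hl ?_ ?_ hn
  · intro d hd0 hd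
    by_contra hdr
    have : s ≤ f d := Nat.sInf_le (Or.inl ⟨d, hd0, hdr, rfl⟩)
    rcases eq_or_ne n 0 with rfl | hn0
    · obtain rfl : d = 1 := by simp at hd; omega
      exact hdr (one_dvd r)
    · exact absurd (hf n d hn0 (hlt.trans_le this)) (not_lt.2 hd)
  · intro h4
    have h1 : s ≤ _ := Nat.sInf_le (Or.inr rfl)
    have h2 : n - 2 ≤ ⌊log (Real.logb 3 (Real.logb 4 ((l : ℝ) / Real.logb 2 v)))⌋₊ := by omega
    have h3 := two_pow_le_of_le_log (by omega) ((Nat.le_floor_iff' (by omega)).1 h2)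
    set y := (l : ℝ) / Real.logb 2 v with hy
    have hy1 : 1 < y := lt_of_lt_of_le (by norm_num) hl
    rw [Real.le_logb_iff_rpow_le (by norm_num) (Real.logb_pos (by norm_num) hy1),
      Real.le_logb_iff_rpow_le (by norm_num) (by linarith)] at h3
    exact_mod_cast h3

lemma lt_of_lt_floor_log_ceil_logb_three {n d : ℕ} (hn : n ≠ 0)
    (h : n < ⌊log (⌈Real.logb 3 d⌉₊ : ℝ)⌋₊ + 1) : 3 ^ (2 ^ n - 1) < d := by
  have h1 := two_pow_le_of_le_log hn ((Nat.le_floor_iff' hn).1 (Nat.lt_succ_iff.1 h))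
  have h2 : 2 ^ n ≤ ⌈Real.logb 3 d⌉₊ := by exact_mod_cast h1
  have h3 : 2 ^ n - 1 < ⌈Real.logb 3 d⌉₊ := by
    have := Nat.one_le_two_pow (n := n); omega
  have h4 := Nat.lt_ceil.1 h3
  have hd : (0 : ℝ) < d := by
    rcases Nat.eq_zero_or_pos d with rfl | hd
    · simp at h4
      exact absurd h4 (not_lt.2 (one_le_pow₀ (by norm_num)))
    · exact_mod_cast hd
  rw [Real.lt_logb_iff_rpow_lt (by norm_num) hd, Real.rpow_natCast] at h4
  exact_mod_cast h4

lemma lt_of_lt_ceil_log_logb_three {n d : ℕ} (hn : n ≠ 0)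
    (h : n < ⌈log (Real.logb 3 d)⌉₊) : 3 ^ (2 ^ n - 1) < d := by
  have h1 := two_pow_le_of_le_log hn (Nat.lt_ceil.1 h).le
  refine lt_of_lt_floor_log_ceil_logb_three hn (Nat.lt_succ_of_le ?_)
  have h2 : (2 : ℝ) ^ n ≤ (⌈Real.logb 3 d⌉₊ : ℝ) := h1.trans (Nat.le_ceil _)
  have h3 : (1 : ℝ) < 2 ^ n := one_lt_pow₀ (by norm_num) hn
  rw [Nat.le_floor_iff' hn, log_eq_logb (h3.trans_le h2),
    Real.le_logb_iff_rpow_le (by norm_num) (by linarith), Real.rpow_natCast]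
  exact h2

lemma lt_of_lt_floor_log_ceil_log {n d : ℕ}
    (h : n < ⌊log (⌈log d⌉₊ : ℝ)⌋₊) : 3 ^ (2 ^ n - 1) < d := by
  have h1 := two_pow_le_of_le_log n.succ_ne_zero ((Nat.le_floor_iff' n.succ_ne_zero).1 h)
  have h2 : 2 ^ (n + 1) ≤ ⌈log d⌉₊ := by exact_mod_cast h1
  have hp := Nat.one_le_two_pow (n := n)
  have h3 : 2 ^ (n + 1) - 1 < ⌈log d⌉₊ := by
    have := Nat.one_le_two_pow (n := n + 1); omega
  have h4 := two_pow_le_of_le_log (by rw [pow_succ]; omega) (Nat.lt_ceil.1 h3).le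
  have h5 : 2 ^ (2 ^ (n + 1) - 1) ≤ d := by exact_mod_cast h4
  refine lt_of_lt_of_le ?_ h5
  calc 3 ^ (2 ^ n - 1) ≤ 4 ^ (2 ^ n - 1) := Nat.pow_le_pow_left (by norm_num) _
    _ = 2 ^ (2 * (2 ^ n - 1)) := by rw [pow_mul]; norm_num
    _ < 2 ^ (2 ^ (n + 1) - 1) := Nat.pow_lt_pow_right (by norm_num) (by rw [pow_succ]; omega)

end PowG

theorem mainTheorem7 (u l v r : ℕ) (hu : u = 2 ^ l * v ^ r) (hv : 1 < v) (hr : 0 < r)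
    (hl : (10 : ℝ) ^ 8 ≤ (l : ℝ) / PowG.log v) :
    ((sInf ({k : ℕ | ∃ d : ℕ, 0 < d ∧ ¬ d ∣ r ∧
              k = ⌊PowG.log (⌈Real.logb 3 d⌉₊ : ℝ)⌋₊ + 1} ∪
            {⌊PowG.log (Real.logb 3 (Real.logb 4 ((l : ℝ) / PowG.log v)))⌋₊ + 3}) : ℕ) : ℕ∞)
        ≤ PowG.complexity [u] ∧
    ((sInf ({k : ℕ | ∃ d : ℕ, 0 < d ∧ ¬ d ∣ r ∧
              k = ⌈PowG.log (Real.logb 3 d)⌉₊} ∪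
            {⌊PowG.log (Real.logb 3 (Real.logb 4 ((l : ℝ) / PowG.log v)))⌋₊ + 3}) : ℕ) : ℕ∞)
        ≤ PowG.complexity [u] ∧
    ((sInf ({k : ℕ | ∃ d : ℕ, 0 < d ∧ ¬ d ∣ r ∧
              k = ⌊PowG.log (⌈PowG.log d⌉₊ : ℝ)⌋₊} ∪
            {⌊PowG.log (Real.logb 3 (Real.logb 4 ((l : ℝ) / PowG.log v)))⌋₊ + 3}) : ℕ) : ℕ∞)
        ≤ PowG.complexity [u] := by
  subst hu
  exact ⟨PowG.sInf_le_complexity hv hr hl _ fun _ _ => PowG.lt_of_lt_floor_log_ceil_logb_three,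
    PowG.sInf_le_complexity hv hr hl _ fun _ _ => PowG.lt_of_lt_ceil_log_logb_three,
    PowG.sInf_le_complexity hv hr hl _ fun _ _ _ => PowG.lt_of_lt_floor_log_ceil_log⟩
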